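/- Definitions. A monad $\mathbb{S}=(S,\eta,\mu)$ on $\mathbf{Set}$ is \emph{consistent} if $\eta_X : X\to SX$ is injective for every set $X$. For a set $E$, the \emph{exception monad} $\mathbb{M}_E$ is $X\mapsto X+E$, with unit the left injection and multiplication the folding of the two copies of $E$. The \emph{Trnková closure} of a monad $\mathbb{S}$ is the (essentially unique) monad $\widehat{\mathbb{S}}$ whose underlying functor preserves finite intersections, together with a monad morphism $r:\mathbb{S}\to\widehat{\mathbb{S}}$ such that $r_X$ is bijective for every nonempty set $X$. The monad $\mathbb{S}$ is \emph{substantially exceptional} if its Trnková closure is isomorphic to $\mathbb{M}_E$ for some set $E$. A \emph{fixpoint} of a set functor $H$ is a cardinal $\lambda$ with $\operatorname{card} H\lambda=\lambda$. A family of set functors has \emph{arbitrarily large joint fixpoints} if for every cardinal $\kappa$ there is a cardinal $\lambda\ge\kappa$ that is a fixpoint of every member of the family. Theorem. Let $(\mathbb{S}_p)_{p\in P}$ be a family, indexed by a set $P$, of consistent monads on $\mathbf{Set}$. The coproduct of this family in the category of monads on $\mathbf{Set}$ and monad morphisms exists if and only if at least one of the following conditions holds: \begin{enumerate} \item the underlying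 functors of those $\mathbb{S}_p$ that are not substantially exceptional have arbitrarily large joint fixpoints; \item all of the monads $\mathbb{S}_p$ except at most one are substantially exceptional. \end{enumerate} -/

import Mathlib

open CategoryTheory CategoryTheory.Limits

universe u

namespace SetMonad

/-- A monad on `Set` is consistent when all its unit components are injective. -/
def IsConsistent (S : Monad (Type u)) : Prop :=
  ∀ X : Type u, Function.Injective (S.η.app X)

/-- The exception monad `X ↦ X + E`, with unit the left injection and multiplication the
folding `(X + E) + E → X + E` of the two copies of `E`. -/
def exceptionMonad (E : Type u) : Monad (Type u) where
  obj X := X ⊕ E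
  map f := ↾(Sum.map f id)
  map_id X := by ext (x | e) <;> rfl
  map_comp f g := by ext (x | e) <;> rfl
  η := { app := fun X => ↾(Sum.inl : X → X ⊕ E), naturality := fun X Y f => by ext x; rfl }
  μ :=
    { app := fun X => ↾(Sum.elim id Sum.inr : (X ⊕ E) ⊕ E → X ⊕ E)
      naturality := fun X Y f => by ext ((x | e) | e) <;> rfl }
  assoc X := by ext (((x | e) | e) | e) <;> rfl
  left_unit X := by ext (x | e) <;> rfl
  right_unit X := by ext (x | e) <;> rfl

/-- A set functor preserves finite intersections when it preserves the pullback of every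
pair of subobjects of a set. -/
def PreservesFiniteIntersections (H : Type u ⥤ Type u) : Prop :=
  ∀ (X Y Z : Type u) (m : X ⟶ Z) (n : Y ⟶ Z), Mono m → Mono n → PreservesLimit (cospan m n) H

/-- A monad morphism `r : S ⟶ T` exhibits `T` as the Trnková closure of the monad `S`:
`T` preserves finite intersections and agrees, along `r`, with `S` on all nonempty sets.
Such an `r` is unique up to a unique isomorphism of `T`. -/
structure IsTrnkovaClosure {S T : Monad (Type u)} (r : S ⟶ T) : Prop where
  preservesFiniteIntersections : PreservesFiniteIntersections T.toFunctor
  bijective_app : ∀ X : Type u, Nonempty X → Function.Bijective (r.app X)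

/-- A monad is substantially exceptional when its Trnková closure is (isomorphic to)
an exception monad. -/
def IsSubstantiallyExceptional (S : Monad (Type u)) : Prop :=
  ∃ (T : Monad (Type u)) (r : S ⟶ T), IsTrnkovaClosure r ∧
    ∃ E : Type u, Nonempty (T ≅ exceptionMonad E)

/-- A cardinal `c` is a fixpoint of a set functor `H` when `card (H c) = c`. -/
def IsFixpoint (H : Type u ⥤ Type u) (c : Cardinal.{u}) : Prop :=
  Cardinal.mk (H.obj c.out) = c

/-- The set functors `H i` have arbitrarily large joint fixpoints. -/
def HaveArbitrarilyLargeJointFixpoints {I : Type u} (H : I → (Type u ⥤ Type u)) : Prop :=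
  ∀ k : Cardinal.{u}, ∃ c : Cardinal.{u}, k ≤ c ∧ ∀ i, IsFixpoint (H i) c

end SetMonad

/-! A coproduct is built from free multialgebras: sets over X with one algebra structure per monad,
free as such. Conversely, a coproduct yields at least weakly free ones. The question becomes when
such sets can exist.

Sufficiency. Consistency splits each `(T p).obj G` into units and nonunits. An element of a free
multialgebra should be either a parameter or a nonunit term for exactly one `p`, so the set is `T
p`-free on the complement of its `p`-terms. A `Frame` keeps this unique decomposition and drops
minimality; its least closed subset is free, since functions out of it can be defined by recursion
(`Frame.IsMinimal.isFreeMultialgebra`). Finding a frame is then pure cardinal arithmetic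
(`exists_frame_of_sets`). A substantially exceptional monad has a fixed number of nonunits over
every nonempty set. Hence either a large joint fixpoint of the other monads absorbs everything, or a
free algebra for the single other monad has room for all the exceptions among its generators.

Necessity. Mapping the coproduct to continuation monads gives a weakly free set F over X. Labelled
terms are generated transfinitely inside F, and distinct terms have distinct values
(`interpret_injective`), because F maps to a multialgebra that separates them
(`exists_common_extension`). This bounds sets `G p`, at least as large as X, such that for `q ≠ p`
the nonunits of `T q` over `G q` number at most `#(G p)`. A monad that is not substantially
exceptional has a nonconstant nonunit, hence at least `#Z` nonunits over every large Z
(`exists_mk_le_mk_nonunits`). With two such monads the inequalities close into a cycle, and the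
common cardinality is a joint fixpoint. -/

namespace SetMonad

/-! ### Elementwise calculus of set monads: constants, nonunits, algebras -/

section Elementary

variable (S : Monad (Type u)) {X Y Z A B C : Type u}

/-- The action of a monad on `Set` on functions. -/
def smap (f : X → Y) : S.obj X → S.obj Y := S.map (↾f)

/-- The unit of a monad on `Set`, as a function. -/
def pure : X → S.obj X := S.η.app X

/-- The multiplication of a monad on `Set`, as a function. -/
def join : S.obj (S.obj X) → S.obj X := S.μ.app X

theorem smap_id (s : S.obj X) : smap S (fun x : X => x) s = s :=
  types_congr_hom (S.map_id X) s

theorem smap_smap (g : Y → Z) (f : X → Y) (s : S.obj X) :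
    smap S g (smap S f s) = smap S (fun x => g (f x)) s :=
  (types_congr_hom (S.map_comp (↾f) (↾g)) s).symm

theorem smap_pure (f : X → Y) (x : X) : smap S f (pure S x) = pure S (f x) :=
  (types_congr_hom (S.η.naturality (↾f)) x).symm

theorem smap_join (f : X → Y) (s : S.obj (S.obj X)) :
    smap S f (join S s) = join S (smap S (smap S f) s) :=
  (types_congr_hom (S.μ.naturality (↾f)) s).symm

theorem join_pure (s : S.obj X) : join S (pure S s) = s :=
  types_congr_hom (S.left_unit X) s

theorem join_smap_pure (s : S.obj X) : join S (smap S (pure S) s) = s :=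
  types_congr_hom (S.right_unit X) s

theorem join_join (s : S.obj (S.obj (S.obj X))) :
    join S (join S s) = join S (smap S (join S) s) :=
  (types_congr_hom (S.assoc X) s).symm

theorem smap_congr {f g : X → Y} (h : ∀ x, f x = g x) (s : S.obj X) :
    smap S f s = smap S g s := by
  rw [funext h]

/-- A nonempty X gives a left inverse of f. For empty X, the element `s` itself supplies a constant
map from Y to `S.obj X`; precomposed with f it is the unit, X being empty, so its Kleisli extension
undoes `smap S f`. -/
theorem smap_injective {f : X → Y} (hf : Function.Injective f) :
    Function.Injective (smap S f) := by
  intro s t h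
  rcases isEmpty_or_nonempty X with hX | hX
  · have key : ∀ r : S.obj X, join S (smap S (fun _ : Y => s) (smap S f r)) = r := by
      intro r
      rw [smap_smap, smap_congr S (g := pure S) (fun x => hX.elim x), join_smap_pure]
    rw [← key s, h, key t]
  · obtain ⟨g, hg⟩ := hf.hasLeftInverse
    have key : ∀ r : S.obj X, smap S g (smap S f r) = r := by
      intro r
      rw [smap_smap, smap_congr S (g := fun x => x) (fun x => hg x), smap_id]
    rw [← key s, h, key t]

/-- An element of `S X` is constant when all functions out of `X` act on it alike. -/
def IsConst (s : S.obj X) : Prop :=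
  ∀ ⦃Z : Type u⦄ (g h : X → Z), smap S g s = smap S h s

variable {S}

theorem IsConst.smap {s : S.obj X} (hs : IsConst S s) (f : X → Y) :
    IsConst S (SetMonad.smap S f s) := by
  intro Z g h
  rw [smap_smap, smap_smap]
  exact hs _ _

theorem isConst_of_isEmpty [IsEmpty X] (s : S.obj X) : IsConst S s :=
  fun _ _ _ => smap_congr S (fun x => isEmptyElim x) s

/-- The two coprojections are the universal pair of maps out of X: every other pair factors through
them. -/
theorem isConst_of_smap_inl_eq_smap_inr {s : S.obj X}
    (h : smap S (Sum.inl : X → X ⊕ X) s = smap S (Sum.inr : X → X ⊕ X) s) : IsConst S s := by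
  intro Z f g
  have := congrArg (SetMonad.smap S (Sum.elim f g)) h
  simpa only [smap_smap, Sum.elim_inl, Sum.elim_inr] using this

theorem IsConst.join {s : S.obj (S.obj X)} (hs : IsConst S s) : IsConst S (join S s) := by
  intro Z g h
  rw [smap_join, smap_join, hs]

theorem IsConsistent.pure_injective (hS : IsConsistent S) :
    Function.Injective (pure S : X → S.obj X) := hS X

theorem IsConsistent.not_isConst_pure (hS : IsConsistent S) (x : X) :
    ¬ IsConst S (pure S x) := by
  intro h
  have := h (fun _ => ULift.up.{u} true) (fun _ => ULift.up.{u} false)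
  rw [smap_pure, smap_pure] at this
  simpa using hS.pure_injective this

variable (S) in
/-- The elements of `S X` that are not units. -/
def nonunits (X : Type u) : Set (S.obj X) := (Set.range (pure S))ᶜ

theorem eq_pure_or_mem_nonunits (s : S.obj X) : (∃ x, pure S x = s) ∨ s ∈ nonunits S X :=
  Classical.em _

theorem IsConst.mem_nonunits (hS : IsConsistent S) {s : S.obj X} (hs : IsConst S s) :
    s ∈ nonunits S X := by
  rintro ⟨x, rfl⟩
  exact hS.not_isConst_pure x hs

theorem smap_mem_nonunits (hS : IsConsistent S) {f : X → Y} (hf : Function.Injective f)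
    {s : S.obj X} (hs : s ∈ nonunits S X) : smap S f s ∈ nonunits S Y := by
  rcases isEmpty_or_nonempty X with hX | hX
  · exact ((isConst_of_isEmpty s).smap f).mem_nonunits hS
  · rintro ⟨y, hy⟩
    obtain ⟨g, hg⟩ := hf.hasLeftInverse
    refine hs ⟨g y, ?_⟩
    rw [← smap_pure, hy, smap_smap, smap_congr S (g := fun x => x) (fun x => hg x), smap_id]

variable (S) in
/-- Eilenberg–Moore algebras, on functions. -/
structure IsAlgebra (a : S.obj A → A) : Prop where
  pure : ∀ x, a (pure S x) = x
  join : ∀ s, a (join S s) = a (smap S a s)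

variable (S) in
/-- Homomorphisms between carriers of algebras. -/
def IsHom (a : S.obj A → A) (b : S.obj B → B) (h : A → B) : Prop :=
  ∀ s, h (a s) = b (smap S h s)

theorem isAlgebra_join : IsAlgebra S (join S : S.obj (S.obj X) → S.obj X) :=
  ⟨join_pure S, join_join S⟩

theorem isHom_id (a : S.obj A → A) : IsHom S a a (fun x => x) :=
  fun s => by rw [smap_id]

theorem IsHom.comp {a : S.obj A → A} {b : S.obj B → B} {c : S.obj C → C} {g : B → C} {f : A → B}
    (hg : IsHom S b c g) (hf : IsHom S a b f) : IsHom S a c (fun x => g (f x)) :=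
  fun s => by simp only [hf s, hg _, smap_smap]

/-- The extension of a map into an algebra to the free algebra is a homomorphism. -/
theorem IsAlgebra.isHom_extend {a : S.obj A → A} (ha : IsAlgebra S a) (f : X → A) :
    IsHom S (SetMonad.join S) a (fun s : S.obj X => a (smap S f s)) := by
  intro s
  simp only
  rw [smap_join, ha.join, smap_smap]

/-- Transport of an algebra along a bijection. -/
theorem IsAlgebra.transport {a : S.obj A → A} (ha : IsAlgebra S a) (e : B ≃ A) :
    IsAlgebra S (fun s : S.obj B => e.symm (a (smap S e s))) := by
  constructor
  · intro x
    rw [smap_pure, ha.pure, e.symm_apply_apply]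
  · intro s
    rw [smap_join, ha.join, smap_smap, smap_smap]
    simp

/-- Powers of algebras. -/
theorem IsAlgebra.pi {a : S.obj A → A} (ha : IsAlgebra S a) (I : Type u) :
    IsAlgebra S (fun (s : S.obj (I → A)) i => a (smap S (fun k => k i) s)) := by
  constructor
  · intro x
    funext i
    rw [smap_pure, ha.pure]
  · intro s
    funext i
    rw [smap_join, ha.join, smap_smap, smap_smap]

variable {P : Type u} (T : P → Monad (Type u))

/-- A family of algebras for the members of a family of monads on a common carrier is freely
generated by `i : X → A`. -/
structure IsFreeMultialgebra (a : ∀ p, (T p).obj A → A) (i : X → A) : Prop where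
  isAlgebra : ∀ p, IsAlgebra (T p) (a p)
  exists_hom : ∀ ⦃C : Type u⦄ (c : ∀ p, (T p).obj C → C), (∀ p, IsAlgebra (T p) (c p)) →
    ∀ f : X → C, ∃ h : A → C, (∀ p, IsHom (T p) (a p) (c p) h) ∧ ∀ x, h (i x) = f x
  hom_ext : ∀ ⦃C : Type u⦄ (c : ∀ p, (T p).obj C → C), (∀ p, IsAlgebra (T p) (c p)) →
    ∀ g h : A → C, (∀ p, IsHom (T p) (a p) (c p) g) → (∀ p, IsHom (T p) (a p) (c p) h) →
      (∀ x, g (i x) = h (i x)) → g = h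

end Elementary

/-! ### Frames and their minimal subframes -/

section Frames

variable {P : Type u} (T : P → Monad (Type u)) (X : Type u)

/-- A frame over `X` is a set that is, for every member of a family of monads, a free algebra on
generators including `X`, in such a way that the sets of nongenerators are pairwise disjoint. -/
structure Frame where
  /-- the underlying set -/
  carrier : Type u
  /-- the generators for each monad -/
  gen : P → Type u
  /-- the freeness bijections -/
  free : ∀ p, (T p).obj (gen p) ≃ carrier
  /-- the inclusion of the parameters -/
  incl : X → carrier
  disjoint : ∀ ⦃p q⦄, p ≠ q → ∀ s ∈ nonunits (T p) (gen p), ∀ t ∈ nonunits (T q) (gen q),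
    free p s ≠ free q t
  incl_injective : Function.Injective incl
  exists_gen : ∀ p x, ∃ l, free p (pure (T p) l) = incl x

namespace Frame

variable {T X} (K : Frame T X)

/-- The inclusion of generators. -/
def ofGen (p : P) (l : K.gen p) : K.carrier := K.free p (pure (T p) l)

/-- The generators lying in a given set. -/
abbrev genIn (p : P) (W : Set K.carrier) : Type u := {l : K.gen p // K.ofGen p l ∈ W}

/-- The one-step closure operator of a frame. -/
def step (hT : ∀ p, IsConsistent (T p)) : Set K.carrier →o Set K.carrier where
  toFun W := Set.range K.incl ∪
    {y | ∃ p, ∃ t ∈ nonunits (T p) (K.genIn p W), K.free p (smap (T p) Subtype.val t) = y}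
  monotone' := by
    rintro V W h y (hy | ⟨p, t, ht, rfl⟩)
    · exact Or.inl hy
    · refine Or.inr ⟨p, smap (T p) (Set.inclusion (s := {l | K.ofGen p l ∈ V})
        (t := {l | K.ofGen p l ∈ W}) (fun l hl => h hl)) t, ?_, ?_⟩
      · exact smap_mem_nonunits (hT p) (Set.inclusion_injective _) ht
      · rw [smap_smap]
        rfl

/-- A frame is minimal when no proper subset is closed. -/
def IsMinimal : Prop :=
  ∀ D : Set K.carrier, (∀ x, K.incl x ∈ D) →
    (∀ p, ∀ t ∈ nonunits (T p) (K.genIn p D), K.free p (smap (T p) Subtype.val t) ∈ D) →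
      ∀ y, y ∈ D

/-- The least closed subset of a frame. -/
def core (hT : ∀ p, IsConsistent (T p)) : Set K.carrier := (K.step hT).lfp

theorem step_core (hT : ∀ p, IsConsistent (T p)) : K.step hT (K.core hT) = K.core hT :=
  (K.step hT).map_lfp

theorem free_smap_val_mem_core (hT : ∀ p, IsConsistent (T p)) (p : P)
    (t : (T p).obj (K.genIn p (K.core hT))) :
    K.free p (smap (T p) Subtype.val t) ∈ K.core hT := by
  rcases eq_pure_or_mem_nonunits t with ⟨l, rfl⟩ | ht
  · rw [smap_pure]
    exact l.2
  · exact (K.step_core hT).subset (Or.inr ⟨p, t, ht, rfl⟩)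

theorem incl_mem_core (hT : ∀ p, IsConsistent (T p)) (x : X) : K.incl x ∈ K.core hT :=
  (K.step_core hT).subset (Or.inl ⟨x, rfl⟩)

/-- For surjectivity, a point of the core is a parameter or a nonunit term for some `q`. If `q ≠ p`,
disjointness prevents it from being a nonunit term for `p`, so it is a `p`-generator lying in the
core. -/
theorem bijective_core (hT : ∀ p, IsConsistent (T p)) (p : P) :
    Function.Bijective (fun t : (T p).obj (K.genIn p (K.core hT)) =>
      (⟨K.free p (smap (T p) Subtype.val t), K.free_smap_val_mem_core hT p t⟩ : K.core hT)) := by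
  constructor
  · intro s t h
    exact smap_injective (T p) Subtype.val_injective ((K.free p).injective (congrArg Subtype.val h))
  · rintro ⟨y, hy⟩
    have gen_case : ∀ l, K.ofGen p l = y → ∃ t : (T p).obj (K.genIn p (K.core hT)),
        (⟨K.free p (smap (T p) Subtype.val t), K.free_smap_val_mem_core hT p t⟩ : K.core hT)
          = ⟨y, hy⟩ := by
      rintro l rfl
      refine ⟨pure (T p) ⟨l, hy⟩, ?_⟩
      ext
      simp only [smap_pure]
      rfl
    have hy' := hy
    rw [← K.step_core hT] at hy'
    rcases hy' with ⟨x, rfl⟩ | ⟨q, t, ht, rfl⟩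
    · obtain ⟨l, hl⟩ := K.exists_gen p x
      exact gen_case l hl
    · by_cases hpq : p = q
      · subst hpq
        exact ⟨t, rfl⟩
      · rcases eq_pure_or_mem_nonunits ((K.free p).symm (K.free q (smap (T q) Subtype.val t)))
          with ⟨l, hl⟩ | hs
        · exact gen_case l (by rw [ofGen, hl, Equiv.apply_symm_apply])
        · exact absurd ((K.free p).apply_symm_apply _)
            (K.disjoint hpq _ hs _ (smap_mem_nonunits (hT q) Subtype.val_injective ht))

/-- The minimal frame inside a frame. -/
noncomputable def minimal (hT : ∀ p, IsConsistent (T p)) : Frame T X where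
  carrier := K.core hT
  gen p := K.genIn p (K.core hT)
  free p := Equiv.ofBijective _ (K.bijective_core hT p)
  incl x := ⟨K.incl x, K.incl_mem_core hT x⟩
  disjoint p q hpq s hs t ht h :=
    K.disjoint hpq _ (smap_mem_nonunits (hT p) Subtype.val_injective hs) _
      (smap_mem_nonunits (hT q) Subtype.val_injective ht) (congrArg Subtype.val h)
  incl_injective x y h := K.incl_injective (congrArg Subtype.val h)
  exists_gen p x := by
    obtain ⟨l, hl⟩ := K.exists_gen p x
    refine ⟨⟨l, ?_⟩, ?_⟩
    · rw [ofGen, hl]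
      exact K.incl_mem_core hT x
    · ext
      simp only [Equiv.ofBijective_apply, smap_pure]
      exact hl

theorem isMinimal_minimal (hT : ∀ p, IsConsistent (T p)) : (K.minimal hT).IsMinimal := by
  intro D hi hs
  have hle : K.core hT ≤ {y | ∃ h : y ∈ K.core hT, (⟨y, h⟩ : K.core hT) ∈ D} := by
    refine (K.step hT).lfp_le ?_
    rintro y (⟨x, rfl⟩ | ⟨p, t, ht, rfl⟩)
    · exact ⟨K.incl_mem_core hT x, hi x⟩
    · have hmem : ∀ l : K.genIn p {y | ∃ h : y ∈ K.core hT, (⟨y, h⟩ : K.core hT) ∈ D},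
          (K.minimal hT).ofGen p ⟨l.1, l.2.1⟩ ∈ D := by
        rintro ⟨l, hl, hl'⟩
        have : (K.minimal hT).ofGen p ⟨l, hl⟩ = ⟨K.ofGen p l, hl⟩ := by
          refine Subtype.ext ?_
          exact congrArg (K.free p) (smap_pure (T p) Subtype.val _)
        rw [this]
        exact hl'
      have h := hs p (smap (T p) (fun l => ⟨⟨l.1, l.2.1⟩, hmem l⟩) t)
        (smap_mem_nonunits (hT p)
          (fun l l' h => Subtype.ext (congrArg (fun z => z.1.1) h)) ht)
      rw [smap_smap] at h
      have e := congrArg (K.free p) (smap_smap (T p) Subtype.val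
        (fun l : K.genIn p {y | ∃ h : y ∈ K.core hT, (⟨y, h⟩ : K.core hT) ∈ D} =>
          (⟨l.1, l.2.1⟩ : K.genIn p (K.core hT))) t)
      have hmem' : K.free p (smap (T p) Subtype.val t) ∈ K.core hT :=
        e ▸ K.free_smap_val_mem_core hT p _
      refine ⟨hmem', ?_⟩
      have e' : (K.minimal hT).free p (smap (T p) (fun l => ⟨l.1, l.2.1⟩) t) =
          (⟨_, hmem'⟩ : K.core hT) := Subtype.ext e
      rw [← e']
      exact h
  rintro ⟨y, hy⟩
  exact (hle hy).2

/-- The algebra structures on the carrier of a frame. -/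
def str (p : P) (s : (T p).obj K.carrier) : K.carrier :=
  K.free p (join (T p) (smap (T p) (K.free p).symm s))

theorem isAlgebra_str (p : P) : IsAlgebra (T p) (K.str p) :=
  (isAlgebra_join (S := T p)).transport (K.free p).symm

theorem str_smap_ofGen (p : P) (u : (T p).obj (K.gen p)) :
    K.str p (smap (T p) (K.ofGen p) u) = K.free p u := by
  simp only [str, ofGen, smap_smap, Equiv.symm_apply_apply]
  exact congrArg _ (join_smap_pure (T p) u)

/-! ### Recursion on a minimal frame -/

variable {C : Type u} (c : ∀ p, (T p).obj C → C) (f : X → C)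

/-- The generators together with a value assigned by a relation. -/
abbrev genRel (p : P) (R : Set (K.carrier × C)) : Type u :=
  {z : K.gen p × C // (K.ofGen p z.1, z.2) ∈ R}

/-- The one-step operator on relations from a frame to a family of algebras. -/
def relStep (hT : ∀ p, IsConsistent (T p)) :
    Set (K.carrier × C) →o Set (K.carrier × C) where
  toFun R := Set.range (fun x => (K.incl x, f x)) ∪
    {y | ∃ p, ∃ t ∈ nonunits (T p) (K.genRel p R),
      (K.free p (smap (T p) (fun z => z.1.1) t), c p (smap (T p) (fun z => z.1.2) t)) = y}
  monotone' := by
    rintro Q R h y (hy | ⟨p, t, ht, rfl⟩)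
    · exact Or.inl hy
    · refine Or.inr ⟨p, smap (T p) (fun z : K.genRel p Q => (⟨z.1, h z.2⟩ : K.genRel p R)) t,
        ?_, ?_⟩
      · exact smap_mem_nonunits (hT p)
          (fun z z' h => Subtype.ext (congrArg (fun z => z.1) h)) ht
      · rw [smap_smap, smap_smap]

/-- Functional relations. -/
def IsFunctional {A : Type u} (R : Set (A × C)) : Prop :=
  ∀ ⦃y c c'⦄, (y, c) ∈ R → (y, c') ∈ R → c = c'

/-- Functionality of R makes the projection from `genRel` to generators injective, so nonunits stay
nonunits there. Disjointness and freeness then recover both the index and the term from the point of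
the frame, and with them its value. -/
theorem isFunctional_relStep (hT : ∀ p, IsConsistent (T p)) {R : Set (K.carrier × C)}
    (hR : IsFunctional R) : IsFunctional (K.relStep c f hT R) := by
  have inj : ∀ p, Function.Injective (fun z : K.genRel p R => z.1.1) := by
    rintro p ⟨⟨l, d⟩, h⟩ ⟨⟨l', d'⟩, h'⟩ (rfl : l = l')
    obtain rfl : d = d' := hR h h'
    rfl
  have mixed : ∀ x p, ∀ t ∈ nonunits (T p) (K.genRel p R),
      K.incl x ≠ K.free p (smap (T p) (fun z => z.1.1) t) := by
    intro x p t ht h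
    obtain ⟨l, hl⟩ := K.exists_gen p x
    rw [← hl] at h
    exact smap_mem_nonunits (hT p) (inj p) ht ⟨l, (K.free p).injective h⟩
  rintro y d d' (⟨x, hx⟩ | ⟨p, t, ht, h⟩) (⟨x', hx'⟩ | ⟨q, t', ht', h'⟩)
  · obtain ⟨h1, rfl⟩ := Prod.mk.inj hx
    obtain ⟨h2, rfl⟩ := Prod.mk.inj hx'
    rw [K.incl_injective (h1.trans h2.symm)]
  · exact absurd ((Prod.mk.inj hx).1.trans (Prod.mk.inj h').1.symm) (mixed _ _ _ ht')
  · exact absurd ((Prod.mk.inj hx').1.trans (Prod.mk.inj h).1.symm) (mixed _ _ _ ht)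
  · obtain ⟨h1, rfl⟩ := Prod.mk.inj h
    obtain ⟨h2, rfl⟩ := Prod.mk.inj h'
    by_cases hpq : p = q
    · subst hpq
      rw [smap_injective (T p) (inj p) ((K.free p).injective (h1.trans h2.symm))]
    · exact absurd (h1.trans h2.symm) (K.disjoint hpq _ (smap_mem_nonunits (hT p) (inj p) ht) _
        (smap_mem_nonunits (hT q) (inj q) ht'))

/-- Unions of functional relations need not be functional, but the transfinite approximations form a
chain: two pairs arising from stages `b` and `b'` both lie in one step applied to stage `max b b'`.
-/
theorem isFunctional_lfp (hT : ∀ p, IsConsistent (T p)) :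
    IsFunctional (K.relStep c f hT).lfp := by
  suffices h : ∀ o, IsFunctional (OrdinalApprox.lfpApprox (K.relStep c f hT) ⊥ o) by
    rw [← OrdinalApprox.lfpApprox_ord_eq_lfp]
    exact h _
  intro o
  induction o using WellFoundedLT.induction with
  | ind o ih =>
    intro y d d' h h'
    rw [OrdinalApprox.lfpApprox] at h h'
    simp only [Set.bot_eq_empty, Set.sup_eq_union, Set.empty_union, Set.iSup_eq_iUnion,
      Set.mem_iUnion] at h h'
    obtain ⟨b, hb, h⟩ := h
    obtain ⟨b', hb', h'⟩ := h'
    have mono := OrdinalApprox.lfpApprox_mono_right (K.relStep c f hT) (x := ⊥)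
    exact K.isFunctional_relStep c f hT (ih (max b b') (max_lt hb hb'))
      ((K.relStep c f hT).monotone (mono (le_max_left b b')) h)
      ((K.relStep c f hT).monotone (mono (le_max_right b b')) h')

/-- The least relation compatible with the structure is functional; its domain is closed, hence
everything by minimality, so it is the graph of the required homomorphism. Uniqueness holds because
the equalizer of two homomorphisms agreeing on parameters is closed. -/
theorem IsMinimal.isFreeMultialgebra {K : Frame T X} (hK : K.IsMinimal)
    (hT : ∀ p, IsConsistent (T p)) : IsFreeMultialgebra T K.str K.incl := by
  refine ⟨K.isAlgebra_str, ?_, ?_⟩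
  · intro C c hc f
    set R := (K.relStep c f hT).lfp with hR
    have hfun : IsFunctional R := K.isFunctional_lfp c f hT
    have hstep : K.relStep c f hT R = R := (K.relStep c f hT).map_lfp
    have hincl : ∀ x, (K.incl x, f x) ∈ R := fun x => by
      rw [← hstep]
      exact Or.inl ⟨x, rfl⟩
    have hfree : ∀ p, ∀ t ∈ nonunits (T p) (K.genRel p R),
        (K.free p (smap (T p) (fun z => z.1.1) t), c p (smap (T p) (fun z => z.1.2) t)) ∈ R := by
      intro p t ht
      exact hstep.subset (Or.inr ⟨p, t, ht, rfl⟩)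
    have total : ∀ y, ∃ d, (y, d) ∈ R := by
      refine hK {y | ∃ d, (y, d) ∈ R} (fun x => ⟨f x, hincl x⟩) ?_
      intro p t ht
      have := hfree p (smap (T p) (fun l => ⟨(l.1, l.2.choose), l.2.choose_spec⟩) t)
        (smap_mem_nonunits (hT p)
          (fun l l' h => Subtype.ext (congrArg (fun z => z.1.1) h)) ht)
      rw [smap_smap, smap_smap] at this
      exact ⟨_, this⟩
    choose g hg using total
    have key : ∀ p (v : (T p).obj (K.gen p)),
        g (K.free p v) = c p (smap (T p) (fun l => g (K.ofGen p l)) v) := by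
      intro p v
      rcases eq_pure_or_mem_nonunits v with ⟨l, rfl⟩ | hv
      · rw [smap_pure, (hc p).pure]
        rfl
      · have := hfree p (smap (T p) (fun l => ⟨(l, g (K.ofGen p l)), hg _⟩) v)
          (smap_mem_nonunits (hT p) (fun l l' h => congrArg (fun z => z.1.1) h) hv)
        rw [smap_smap, smap_smap, smap_id] at this
        exact hfun (hg _) this
    refine ⟨g, ?_, fun x => hfun (hg _) (hincl x)⟩
    intro p s
    rw [str, key, smap_join, (hc p).join, smap_smap, smap_smap]
    refine congrArg _ (smap_congr _ (fun y => ?_) s)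
    rw [← key, Equiv.apply_symm_apply]
  · intro C c _ g h hg hh hgh
    funext y
    refine hK {y | g y = h y} hgh ?_ y
    intro p t _
    simp only [Set.mem_ofPred_eq]
    rw [← str_smap_ofGen, hg, hh, smap_smap, smap_smap, smap_smap, smap_smap]
    exact congrArg _ (smap_congr _ (fun l => l.2) t)

theorem exists_isFreeMultialgebra (hT : ∀ p, IsConsistent (T p)) (K : Frame T X) :
    ∃ (F : Type u) (a : ∀ p, (T p).obj F → F) (i : X → F), IsFreeMultialgebra T a i :=
  ⟨_, _, _, (K.isMinimal_minimal hT).isFreeMultialgebra hT⟩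

end Frame

end Frames

/-! ### Coproducts of monads and free multialgebras -/

section Coproducts

variable {P : Type u} {T : P → Monad (Type u)}

theorem app_pure {S R : Monad (Type u)} (r : S ⟶ R) {X : Type u} (x : X) :
    r.app X (pure S x) = pure R x :=
  types_congr_hom (r.app_η X) x

theorem app_join {S R : Monad (Type u)} (r : S ⟶ R) {X : Type u} (s : S.obj (S.obj X)) :
    r.app X (join S s) = join R (r.app _ (smap S (r.app X) s)) :=
  types_congr_hom (r.app_μ X) s

theorem app_smap {S R : Monad (Type u)} (r : S ⟶ R) {X Y : Type u} (f : X → Y) (s : S.obj X) :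
    r.app Y (smap S f s) = smap R f (r.app X s) :=
  types_congr_hom (r.toNatTrans.naturality (↾f)) s

/-- Build a monad morphism from a natural family of functions. -/
def homMk {S R : Monad (Type u)} (r : ∀ X : Type u, S.obj X → R.obj X)
    (hmap : ∀ (X Y : Type u) (f : X → Y) s, r Y (smap S f s) = smap R f (r X s))
    (hpure : ∀ (X : Type u) (x : X), r X (pure S x) = pure R x)
    (hjoin : ∀ (X : Type u) s, r X (join S s) = join R (r _ (smap S (r X) s))) : S ⟶ R where
  app X := ↾(r X)
  naturality X Y f := by ext s; exact hmap X Y f s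
  app_η X := by ext x; exact hpure X x
  app_μ X := by ext s; exact hjoin X s

/-- Build a monad on `Set` from functions. -/
def monadMk (F : Type u → Type u) (map : ∀ {X Y : Type u}, (X → Y) → F X → F Y)
    (unit : ∀ {X : Type u}, X → F X) (mul : ∀ {X : Type u}, F (F X) → F X)
    (map_id : ∀ (X : Type u) (s : F X), map (fun x => x) s = s)
    (map_comp : ∀ (X Y Z : Type u) (f : X → Y) (g : Y → Z) (s : F X),
      map (fun x => g (f x)) s = map g (map f s))
    (map_unit : ∀ (X Y : Type u) (f : X → Y) (x : X), map f (unit x) = unit (f x))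
    (map_mul : ∀ (X Y : Type u) (f : X → Y) (s : F (F X)), map f (mul s) = mul (map (map f) s))
    (mul_unit : ∀ (X : Type u) (s : F X), mul (unit s) = s)
    (mul_map_unit : ∀ (X : Type u) (s : F X), mul (map unit s) = s)
    (mul_mul : ∀ (X : Type u) (s : F (F (F X))), mul (mul s) = mul (map mul s)) :
    Monad (Type u) where
  obj := F
  map f := ↾(map f)
  map_id X := by ext s; exact map_id X s
  map_comp f g := by ext s; exact map_comp _ _ _ f g s
  η := { app := fun X => ↾unit, naturality := fun X Y f => by ext x; exact (map_unit X Y f x).symm }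
  μ := { app := fun X => ↾mul, naturality := fun X Y f => by ext x; exact (map_mul X Y f x).symm }
  assoc X := by ext s; exact (mul_mul X s).symm
  left_unit X := by ext s; exact mul_unit X s
  right_unit X := by ext s; exact mul_map_unit X s

/-- A monad morphism turns free algebras for its codomain into algebras for its domain. -/
theorem isAlgebra_of_hom {S R : Monad (Type u)} (r : S ⟶ R) {A : Type u} {a : R.obj A → A}
    (ha : IsAlgebra R a) : IsAlgebra S (fun s => a (r.app A s)) := by
  constructor
  · intro x
    rw [app_pure, ha.pure]
  · intro s
    rw [app_join, ha.join, app_smap, smap_smap, app_smap]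

/-- The continuation monad. -/
def continuationMonad (C : Type u) : Monad (Type u) :=
  monadMk (fun X => (X → C) → C) (fun f s k => s (fun x => k (f x))) (fun x k => k x)
    (fun s k => s (fun t => t k)) (fun _ _ => rfl) (fun _ _ _ _ _ _ => rfl)
    (fun _ _ _ _ => rfl) (fun _ _ _ _ => rfl) (fun _ _ => rfl) (fun _ _ => rfl) (fun _ _ => rfl)

/-- Application of an element of the continuation monad. -/
def run {C X : Type u} (s : (continuationMonad C).obj X) (k : X → C) : C :=
  (s : (X → C) → C) k

theorem run_join {C X : Type u} (s : (continuationMonad C).obj ((continuationMonad C).obj X))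
    (k : X → C) : run (join _ s) k = run s (fun t => run t k) := rfl

theorem run_pure {C X : Type u} (x : X) (k : X → C) :
    run (pure (continuationMonad C) x) k = k x := rfl

theorem run_smap {C X Y : Type u} (f : X → Y) (s : (continuationMonad C).obj X) (k : Y → C) :
    run (smap _ f s) k = run s (fun x => k (f x)) := rfl

theorem run_ext {C X : Type u} {s t : (continuationMonad C).obj X}
    (h : ∀ k, run s k = run t k) : s = t := funext h

/-- An algebra induces a monad morphism into the continuation monad. -/
def toContinuation {S : Monad (Type u)} {C : Type u} {c : S.obj C → C} (hc : IsAlgebra S c) :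
    S ⟶ continuationMonad C :=
  homMk (fun _ s k => c (smap S k s))
    (fun X Y f s => run_ext fun k => congrArg c (smap_smap S k f s))
    (fun X x => run_ext fun k => by
      rw [run_pure, ← hc.pure (k x), ← smap_pure]
      rfl)
    (fun X s => run_ext fun k =>
      (hc.isHom_extend k s).trans (congrArg c
        (smap_smap S (fun t => run t k) (fun t k => c (smap S k t)) s).symm))

theorem run_toContinuation {S : Monad (Type u)} {C X : Type u} {c : S.obj C → C}
    (hc : IsAlgebra S c) (s : S.obj X) (k : X → C) :
    run ((toContinuation hc).app X s) k = c (smap S k s) := rfl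

variable (T) in
/-- A coproduct of monads is weakly initial among families of algebras. -/
theorem exists_multialgebra_of_hasCoproduct [HasCoproduct T] (X : Type u) :
    ∃ (F : Type u) (a : ∀ p, (T p).obj F → F) (i : X → F), (∀ p, IsAlgebra (T p) (a p)) ∧
      ∀ ⦃C : Type u⦄ (c : ∀ p, (T p).obj C → C), (∀ p, IsAlgebra (T p) (c p)) →
      ∀ f : X → C, ∃ h : F → C, (∀ p, IsHom (T p) (a p) (c p) h) ∧ ∀ x, h (i x) = f x := by
  refine ⟨(∐ T).obj X, fun p s => join _ ((Sigma.ι T p).app _ s), pure _,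
    fun p => isAlgebra_of_hom _ isAlgebra_join, ?_⟩
  intro C c hc f
  -- An algebra structure on C is encoded as a morphism to the continuation monad of C, so a whole
  -- family of them induces one morphism from the coproduct. Running the result at the continuation
  -- `f` gives the homomorphism.
  set d : (∐ T) ⟶ continuationMonad C := Sigma.desc (fun p => toContinuation (hc p)) with hd
  have hι : ∀ p, Sigma.ι T p ≫ d = toContinuation (hc p) := fun p => by simp [hd]
  refine ⟨fun t => run (d.app X t) f, ?_, ?_⟩
  · intro p s
    simp only
    rw [app_join, run_join, app_smap, run_smap, ← run_toContinuation (hc p), ← hι p]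
    rfl
  · intro x
    simp only
    rw [app_pure, run_pure]

/-! ### The monad of free multialgebras as a coproduct -/

section Free

variable {F : Type u → Type u} {a : ∀ X p, (T p).obj (F X) → F X} {i : ∀ X, X → F X}

/-- The homomorphic extension of a map between free families of algebras. -/
noncomputable def lift (hF : ∀ X, IsFreeMultialgebra T (a X) (i X)) {X Y : Type u}
    (f : X → F Y) : F X → F Y :=
  ((hF X).exists_hom (a Y) (hF Y).isAlgebra f).choose

theorem isHom_lift (hF : ∀ X, IsFreeMultialgebra T (a X) (i X)) {X Y : Type u}
    (f : X → F Y) (p : P) : IsHom (T p) (a X p) (a Y p) (lift hF f) :=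
  ((hF X).exists_hom (a Y) (hF Y).isAlgebra f).choose_spec.1 p

theorem lift_incl (hF : ∀ X, IsFreeMultialgebra T (a X) (i X)) {X Y : Type u}
    (f : X → F Y) (x : X) : lift hF f (i X x) = f x :=
  ((hF X).exists_hom (a Y) (hF Y).isAlgebra f).choose_spec.2 x

theorem lift_ext (hF : ∀ X, IsFreeMultialgebra T (a X) (i X)) {X C : Type u}
    {c : ∀ p, (T p).obj C → C} (hc : ∀ p, IsAlgebra (T p) (c p)) {g h : F X → C}
    (hg : ∀ p, IsHom (T p) (a X p) (c p) g) (hh : ∀ p, IsHom (T p) (a X p) (c p) h)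
    (e : ∀ x, g (i X x) = h (i X x)) (s : F X) : g s = h s :=
  congrFun ((hF X).hom_ext c hc g h hg hh e) s

/-- The monad of free families of algebras. -/
noncomputable def freeMonad (hF : ∀ X, IsFreeMultialgebra T (a X) (i X)) : Monad (Type u) :=
  monadMk F (fun {X Y} f => lift hF (fun x => i Y (f x))) (fun {X} => i X)
    (fun {X} => lift hF (fun s => s))
    (fun X => lift_ext hF (hF X).isAlgebra (isHom_lift hF _) (fun p => isHom_id _)
      (fun x => lift_incl hF _ x))
    (fun X Y Z f g => lift_ext hF (hF Z).isAlgebra (isHom_lift hF _)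
      (fun p => (isHom_lift hF _ p).comp (isHom_lift hF _ p))
      (fun x => by simp only [lift_incl]))
    (fun _ Y f x => lift_incl hF (fun y => i Y (f y)) x)
    (fun X Y f => lift_ext hF (hF Y).isAlgebra
      (fun p => (isHom_lift hF _ p).comp (isHom_lift hF _ p))
      (fun p => (isHom_lift hF _ p).comp (isHom_lift hF _ p))
      (fun x => by simp only [lift_incl]))
    (fun X s => lift_incl hF _ s)
    (fun X => lift_ext hF (hF X).isAlgebra
      (fun p => (isHom_lift hF _ p).comp (isHom_lift hF _ p)) (fun p => isHom_id _)
      (fun x => by simp only [lift_incl]))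
    (fun X => lift_ext hF (hF X).isAlgebra
      (fun p => (isHom_lift hF _ p).comp (isHom_lift hF _ p))
      (fun p => (isHom_lift hF _ p).comp (isHom_lift hF _ p))
      (fun x => by simp only [lift_incl]))

theorem lift_str_incl (hF : ∀ X, IsFreeMultialgebra T (a X) (i X)) (p : P) {X Y Z : Type u}
    (f : Z → X) (g : X → F Y) (s : (T p).obj Z) :
    lift hF g (a X p (smap (T p) (fun z => i X (f z)) s)) =
      a Y p (smap (T p) (fun z => g (f z)) s) := by
  rw [isHom_lift hF _ p, smap_smap]
  simp only [lift_incl]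

theorem str_smap_incl_join (hF : ∀ X, IsFreeMultialgebra T (a X) (i X)) (p : P) {X : Type u}
    (s : (T p).obj ((T p).obj X)) :
    a X p (smap (T p) (i X) (join (T p) s)) =
      a X p (smap (T p) (fun t => a X p (smap (T p) (i X) t)) s) :=
  ((hF X).isAlgebra p).isHom_extend (i X) s

/-- The coprojections into the monad of free families of algebras. -/
noncomputable def freeMonadIncl (hF : ∀ X, IsFreeMultialgebra T (a X) (i X)) (p : P) :
    T p ⟶ freeMonad hF :=
  homMk (fun X s => a X p (smap (T p) (i X) s))
    (fun _ Y f s => (congrArg (a Y p) (smap_smap (T p) (i Y) f s)).trans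
      (lift_str_incl hF p (fun x => x) (fun x => i Y (f x)) s).symm)
    (fun X x => (congrArg (a X p) (smap_pure (T p) (i X) x)).trans
      (((hF X).isAlgebra p).pure (i X x)))
    (fun X s => (str_smap_incl_join hF p s).trans
      ((lift_str_incl hF p (fun t => a X p (smap (T p) (i X) t)) (fun y => y) s).symm.trans
        (congrArg (fun t => lift hF (fun y => y) (a (F X) p t))
          (smap_smap (T p) (i (F X)) (fun t => a X p (smap (T p) (i X) t)) s).symm)))

section Desc

variable {R : Monad (Type u)} (r : ∀ p, T p ⟶ R)

theorem isHom_smap_of_hom (p : P) {X Y : Type u} (f : X → Y) :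
    IsHom (T p) (fun s => join R ((r p).app _ s)) (fun s => join R ((r p).app _ s))
      (smap R f) := by
  intro s
  simp only
  rw [smap_join, app_smap]

theorem isHom_join_of_hom (p : P) {X : Type u} :
    IsHom (T p) (fun s => join R ((r p).app _ s)) (fun s => join R ((r p).app _ s))
      (join R : R.obj (R.obj X) → R.obj X) := by
  intro s
  simp only
  rw [join_join, app_smap]

/-- The components of the monad morphism out of the monad of free families of algebras. -/
noncomputable def descApp (hF : ∀ X, IsFreeMultialgebra T (a X) (i X)) (X : Type u) :
    F X → R.obj X :=
  ((hF X).exists_hom (fun p s => join R ((r p).app _ s))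
    (fun p => isAlgebra_of_hom (r p) isAlgebra_join) (pure R)).choose

theorem isHom_descApp (hF : ∀ X, IsFreeMultialgebra T (a X) (i X)) (X : Type u) (p : P) :
    IsHom (T p) (a X p) (fun s => join R ((r p).app _ s)) (descApp r hF X) :=
  ((hF X).exists_hom (fun p s => join R ((r p).app _ s))
    (fun p => isAlgebra_of_hom (r p) isAlgebra_join) (pure R)).choose_spec.1 p

theorem descApp_incl (hF : ∀ X, IsFreeMultialgebra T (a X) (i X)) (X : Type u) (x : X) :
    descApp r hF X (i X x) = pure R x :=
  ((hF X).exists_hom (fun p s => join R ((r p).app _ s))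
    (fun p => isAlgebra_of_hom (r p) isAlgebra_join) (pure R)).choose_spec.2 x

/-- The monad morphism out of the monad of free families of algebras. -/
noncomputable def freeMonadDesc (hF : ∀ X, IsFreeMultialgebra T (a X) (i X)) :
    freeMonad hF ⟶ R :=
  homMk (descApp r hF)
    (fun X Y f => lift_ext hF (fun p => isAlgebra_of_hom (r p) isAlgebra_join)
      (fun p => (isHom_descApp r hF Y p).comp (isHom_lift hF _ p))
      (fun p => (isHom_smap_of_hom r p f).comp (isHom_descApp r hF X p))
      (fun x => (congrArg (descApp r hF Y) (lift_incl hF _ x)).trans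
        ((descApp_incl r hF Y (f x)).trans ((smap_pure R f x).symm.trans
          (congrArg (smap R f) (descApp_incl r hF X x).symm)))))
    (fun X x => descApp_incl r hF X x)
    (fun X => lift_ext hF (fun p => isAlgebra_of_hom (r p) isAlgebra_join)
      (fun p => (isHom_descApp r hF X p).comp (isHom_lift hF _ p))
      (fun p => (isHom_join_of_hom r p).comp
        ((isHom_descApp r hF _ p).comp (isHom_lift hF _ p)))
      (fun x => (congrArg (descApp r hF X) (lift_incl hF _ x)).trans
        ((join_pure R (descApp r hF X x)).symm.trans (congrArg (join R)
          ((descApp_incl r hF _ (descApp r hF X x)).symm.trans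
            (congrArg (descApp r hF _)
              (lift_incl hF (fun y => i _ (descApp r hF X y)) x).symm))))))

/-- The structure map `a X p` is recovered from the monad as `join` after the coprojection, and `m`
respects both. This yields uniqueness of the mediating morphism, since homomorphisms agreeing on
generators coincide. -/
theorem freeMonad_isHom_of_comp (hF : ∀ X, IsFreeMultialgebra T (a X) (i X))
    (m : freeMonad hF ⟶ R) (hm : ∀ p, freeMonadIncl hF p ≫ m = r p) (X : Type u) (p : P) :
    IsHom (T p) (a X p) (fun s => join R ((r p).app _ s)) (m.app X) := by
  intro s
  have h1 : join (freeMonad hF) ((freeMonadIncl hF p).app _ s) = a X p s :=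
    (lift_str_incl hF p (fun y => y) (fun y => y) s).trans (congrArg (a X p) (smap_id (T p) s))
  have h2 : (r p).app _ (smap (T p) (m.app X) s)
      = m.app _ ((freeMonadIncl hF p).app _ (smap (T p) (m.app X) s)) := by
    rw [← hm p]
    rfl
  have h3 := app_join m ((freeMonadIncl hF p).app ((freeMonad hF).obj X) s)
  have h4 := app_smap (freeMonadIncl hF p) (m.app X) s
  exact (congrArg (m.app X) h1.symm).trans (h3.trans
    ((congrArg (fun t => join R (m.app _ t)) h4.symm).trans (congrArg (join R) h2.symm)))

end Desc

theorem hasCoproduct_of_isFree (hF : ∀ X, IsFreeMultialgebra T (a X) (i X)) :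
    HasCoproduct T := by
  refine HasColimit.mk ⟨Cofan.mk (freeMonad hF) (freeMonadIncl hF), ?_⟩
  refine Cofan.IsColimit.mk _ (fun c => freeMonadDesc c.inj hF) ?_ ?_
  · intro c p
    ext X s
    change descApp c.inj hF X (a X p (smap (T p) (i X) s)) = (c.inj p).app X s
    rw [isHom_descApp c.inj hF X p, smap_smap]
    simp only [descApp_incl]
    erw [app_smap (c.inj p) (pure _) s]
    exact join_smap_pure _ _
  · intro c m hm
    ext X s
    exact lift_ext hF (fun p => isAlgebra_of_hom (c.inj p) isAlgebra_join)
      (freeMonad_isHom_of_comp c.inj hF m hm X) (isHom_descApp c.inj hF X)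
      (fun x => (app_pure m x).trans (descApp_incl c.inj hF X x).symm) s

end Free

end Coproducts

/-! ### Substantially exceptional monads and the count of nonunits -/

section Exceptional

variable {S : Monad (Type u)}

theorem preservesFiniteIntersections_exceptionMonad (E : Type u) :
    PreservesFiniteIntersections (exceptionMonad E).toFunctor := by
  intro X Y Z m n _ _
  have hp := IsPullback.of_hasPullback m n
  refine preservesLimit_of_preserves_limit_cone hp.isLimit
    ((isLimitMapConePullbackConeEquiv _ hp.w).symm (IsPullback.isLimit ?_))
  rw [Types.isPullback_iff] at hp ⊢
  obtain ⟨hw, hinj, hex⟩ := hp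
  refine ⟨by rw [← Functor.map_comp, hw, Functor.map_comp], ?_, ?_⟩
  · rintro (x | e) (y | e') ⟨h, h'⟩
    · exact congrArg Sum.inl (hinj _ _ ⟨Sum.inl.inj h, Sum.inl.inj h'⟩)
    · cases h
    · cases h
    · exact congrArg Sum.inr (Sum.inr.inj h)
  · rintro (x | e) (y | e') h
    · obtain ⟨z, hz, hz'⟩ := hex x y (Sum.inl.inj h)
      exact ⟨Sum.inl z, congrArg Sum.inl hz, congrArg Sum.inl hz'⟩
    · cases h
    · cases h
    · exact ⟨Sum.inr e, rfl, congrArg Sum.inr (Sum.inr.inj h)⟩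

theorem IsSubstantiallyExceptional.exists_hom (h : IsSubstantiallyExceptional S) :
    ∃ (E : Type u) (r : S ⟶ exceptionMonad E),
      ∀ X : Type u, Nonempty X → Function.Bijective (r.app X) := by
  obtain ⟨T, r, hr, E, ⟨e⟩⟩ := h
  refine ⟨E, r ≫ e.hom, fun X hX => ?_⟩
  have he : Function.Bijective (e.hom.app X) := by
    refine Function.bijective_iff_has_inverse.2 ⟨e.inv.app X, fun x => ?_, fun x => ?_⟩
    · exact types_congr_hom (congrArg (fun f : T ⟶ T => f.app X) e.hom_inv_id) x
    · exact types_congr_hom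
        (congrArg (fun f : exceptionMonad E ⟶ exceptionMonad E => f.app X) e.inv_hom_id) x
  exact he.comp (hr.bijective_app X hX)

variable (S) in
/-- The constants of a monad on `Set`. -/
abbrev Constants : Type u := {e : S.obj PUnit.{u + 1} // IsConst S e}

open Classical in
/-- The comparison with the exception monad on the constants, when all nonunits are constant. -/
noncomputable def toException (hc : ∀ (Y : Type u), ∀ s ∈ nonunits S Y, IsConst S s) {X : Type u}
    (s : S.obj X) : X ⊕ Constants S :=
  if h : ∃ x, pure S x = s then Sum.inl h.choose
  else Sum.inr ⟨smap S (fun _ => PUnit.unit) s, (hc X s h).smap _⟩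

theorem toException_pure (hS : IsConsistent S)
    (hc : ∀ (Y : Type u), ∀ s ∈ nonunits S Y, IsConst S s) {X : Type u} (x : X) :
    toException hc (pure S x) = Sum.inl x := by
  have h : ∃ y, pure S y = pure S x := ⟨x, rfl⟩
  rw [toException, dif_pos h, hS.pure_injective h.choose_spec]

theorem toException_of_mem_nonunits
    (hc : ∀ (Y : Type u), ∀ s ∈ nonunits S Y, IsConst S s) {X : Type u} {s : S.obj X}
    (hs : s ∈ nonunits S X) :
    toException hc s = Sum.inr ⟨smap S (fun _ => PUnit.unit) s, (hc X s hs).smap _⟩ :=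
  dif_neg hs

/-- A point `x₀` of X is what allows a nonunit to be recovered from its image over the one-point
set: being constant, it is fixed by the constant map at `x₀`. -/
theorem bijective_toException (hS : IsConsistent S)
    (hc : ∀ (Y : Type u), ∀ s ∈ nonunits S Y, IsConst S s) {X : Type u} [hX : Nonempty X] :
    Function.Bijective (toException hc : S.obj X → X ⊕ Constants S) := by
  obtain ⟨x₀⟩ := hX
  have recover : ∀ s ∈ nonunits S X,
      smap S (fun _ => x₀) (smap S (fun _ => PUnit.unit.{u + 1}) s) = s := by
    intro s hs
    rw [smap_smap, hc X s hs _ (fun x => x), smap_id]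
  constructor
  · intro s t h
    rcases eq_pure_or_mem_nonunits s with ⟨x, rfl⟩ | hs <;>
      rcases eq_pure_or_mem_nonunits t with ⟨y, rfl⟩ | ht
    · rw [toException_pure hS, toException_pure hS] at h
      rw [Sum.inl.inj h]
    · rw [toException_pure hS, toException_of_mem_nonunits hc ht] at h
      cases h
    · rw [toException_pure hS, toException_of_mem_nonunits hc hs] at h
      cases h
    · rw [toException_of_mem_nonunits hc hs, toException_of_mem_nonunits hc ht] at h
      have h' : smap S (fun _ => PUnit.unit.{u + 1}) s = smap S (fun _ => PUnit.unit) t :=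
        congrArg Subtype.val (Sum.inr.inj h)
      rw [← recover s hs, h', recover t ht]
  · rintro (x | ⟨e, he⟩)
    · exact ⟨_, toException_pure hS hc x⟩
    · refine ⟨smap S (fun _ => x₀) e, ?_⟩
      rw [toException_of_mem_nonunits hc ((he.smap _).mem_nonunits hS)]
      refine congrArg Sum.inr (Subtype.ext ?_)
      exact (smap_smap S _ _ e).trans (smap_id S e)

theorem toException_smap (hS : IsConsistent S)
    (hc : ∀ (Y : Type u), ∀ s ∈ nonunits S Y, IsConst S s) {X Y : Type u} (f : X → Y)
    (s : S.obj X) : toException hc (smap S f s) = Sum.map f id (toException hc s) := by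
  rcases eq_pure_or_mem_nonunits s with ⟨x, rfl⟩ | hs
  · rw [smap_pure, toException_pure hS, toException_pure hS]
    rfl
  · rw [toException_of_mem_nonunits hc hs,
      toException_of_mem_nonunits hc (((hc X s hs).smap f).mem_nonunits hS)]
    exact congrArg Sum.inr (Subtype.ext (smap_smap S _ f s))

theorem toException_join (hS : IsConsistent S)
    (hc : ∀ (Y : Type u), ∀ s ∈ nonunits S Y, IsConst S s) {X : Type u} (s : S.obj (S.obj X)) :
    toException hc (join S s) =
      Sum.elim id Sum.inr (toException hc (smap S (toException hc) s)) := by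
  rcases eq_pure_or_mem_nonunits s with ⟨x, rfl⟩ | hs
  · rw [smap_pure, toException_pure hS, join_pure]
    rfl
  · rw [toException_of_mem_nonunits hc ((hc _ s hs).join.mem_nonunits hS),
      toException_of_mem_nonunits hc (((hc _ s hs).smap _).mem_nonunits hS)]
    refine congrArg Sum.inr (Subtype.ext ?_)
    change smap S (fun _ => PUnit.unit) (join S s) =
      smap S (fun _ => PUnit.unit) (smap S (toException hc) s)
    -- Constancy of `s` allows the inner map to be replaced by the constant map at a unit, after
    -- which a unit law removes the multiplication.
    rw [smap_join, smap_smap, hc _ s hs _ (fun _ => pure S PUnit.unit),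
      ← smap_smap S (pure S) (fun _ => PUnit.unit), join_smap_pure]

/-- The comparison with the exception monad on the constants is a monad morphism. -/
noncomputable def exceptionHom (hS : IsConsistent S)
    (hc : ∀ (Y : Type u), ∀ s ∈ nonunits S Y, IsConst S s) :
    S ⟶ exceptionMonad (Constants S) :=
  homMk (fun _ => toException hc) (fun _ _ f s => toException_smap hS hc f s)
    (fun _ x => toException_pure hS hc x) (fun _ s => toException_join hS hc s)

/-- Exception monads preserve finite intersections, so the comparison morphism itself is a Trnková
closure. -/
theorem isSubstantiallyExceptional_of_isConst (hS : IsConsistent S)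
    (hc : ∀ (Y : Type u), ∀ s ∈ nonunits S Y, IsConst S s) : IsSubstantiallyExceptional S :=
  ⟨_, exceptionHom hS hc,
    ⟨preservesFiniteIntersections_exceptionMonad _, fun _ _ => bijective_toException hS hc⟩,
    _, ⟨Iso.refl _⟩⟩

open Cardinal

/-- For a monad that is not substantially exceptional, the nonunits over a large enough set are
at least as numerous as the elements of that set. -/
theorem exists_mk_le_mk_nonunits (hS : IsConsistent S) (h : ¬ IsSubstantiallyExceptional S) :
    ∃ k : Cardinal.{u}, ∀ Z : Type u, Infinite Z → k ≤ #Z → #Z ≤ #(nonunits S Z) := by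
  obtain ⟨Y, s, hs, hns⟩ : ∃ (Y : Type u), ∃ s ∈ nonunits S Y, ¬ IsConst S s := by
    by_contra! hcon
    exact h (isSubstantiallyExceptional_of_isConst hS hcon)
  refine ⟨#Y, fun Z hZ hYZ => ?_⟩
  have : Nonempty Y := by
    by_contra hY
    rw [not_nonempty_iff] at hY
    exact hns (isConst_of_isEmpty s)
  -- Z is cut into Z-many disjoint copies of Y, and the nonconstant nonunit `s` is placed in each
  -- copy.
  have hcard : #(Z × Y) = #Z := by
    rw [mk_prod, lift_id, lift_id]
    exact mul_eq_left (aleph0_le_mk Z) hYZ (mk_ne_zero Y)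
  obtain ⟨e⟩ := Cardinal.eq.1 hcard
  have inj : ∀ z, Function.Injective (fun y => e (z, y)) := fun z y y' h => by
    simpa using e.injective h
  refine mk_le_of_injective (f := fun z => (⟨smap S (fun y => e (z, y)) s,
    smap_mem_nonunits hS (inj z) hs⟩ : nonunits S Z)) ?_
  intro z z' hzz
  by_contra hne
  apply hns
  apply isConst_of_smap_inl_eq_smap_inr
  classical
  -- The copy of Y indexed by `z` is sent to the left summand and all the others to the right.
  -- Equality of the placements at `z` and `z'` would identify both coprojections of `s`, making it
  -- constant.
  have := congrArg (smap S (fun w => if (e.symm w).1 = z then (Sum.inl (e.symm w).2 : Y ⊕ Y)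
    else Sum.inr (e.symm w).2)) (congrArg Subtype.val hzz)
  simpa [smap_smap, Ne.symm hne] using this

end Exceptional

/-! ### Existence of frames by cardinal arithmetic -/

section FrameConstructions

open Cardinal

/-- Every element is either a unit or a nonunit. -/
noncomputable def unitEquiv {S : Monad (Type u)} (hS : IsConsistent S) (X : Type u) :
    X ⊕ nonunits S X ≃ S.obj X :=
  Equiv.ofBijective (Sum.elim (pure S) Subtype.val) (by
    constructor
    · rintro (x | ⟨s, hs⟩) (y | ⟨t, ht⟩) h
      · exact congrArg Sum.inl (hS.pure_injective h)
      · exact absurd ⟨x, h⟩ ht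
      · exact absurd ⟨y, h.symm⟩ hs
      · exact congrArg Sum.inr (Subtype.ext h)
    · intro s
      rcases eq_pure_or_mem_nonunits s with ⟨x, rfl⟩ | hs
      · exact ⟨Sum.inl x, rfl⟩
      · exact ⟨Sum.inr ⟨s, hs⟩, rfl⟩)

theorem unitEquiv_inl {S : Monad (Type u)} (hS : IsConsistent S) {X : Type u} (x : X) :
    unitEquiv hS X (Sum.inl x) = pure S x := rfl

theorem mk_obj {S : Monad (Type u)} (hS : IsConsistent S) (X : Type u) :
    #(S.obj X) = #X + #(nonunits S X) := by
  rw [← mk_congr (unitEquiv hS X), mk_sum, lift_id, lift_id]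

theorem mk_nonunits_le {S : Monad (Type u)} (hS : IsConsistent S) {X Y : Type u} (f : X → Y)
    (hf : Function.Injective f) : #(nonunits S X) ≤ #(nonunits S Y) :=
  mk_le_of_injective (f := fun s => (⟨smap S f s, smap_mem_nonunits hS hf s.2⟩ : nonunits S Y))
    (fun _ _ h => Subtype.ext (smap_injective S hf (congrArg Subtype.val h)))

theorem mk_nonunits_congr {S : Monad (Type u)} (hS : IsConsistent S) {X Y : Type u}
    (h : #X = #Y) : #(nonunits S X) = #(nonunits S Y) := by
  obtain ⟨e⟩ := Cardinal.eq.1 h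
  exact le_antisymm (mk_nonunits_le hS e e.injective) (mk_nonunits_le hS e.symm e.symm.injective)

/-- The bijection respects units, so the nonunits correspond exactly to the right summand. -/
theorem mk_nonunits_of_exception {S : Monad (Type u)} {E X : Type u}
    (r : S ⟶ exceptionMonad E) (hr : Function.Bijective (r.app X)) : #(nonunits S X) = #E := by
  have hex : ∀ e : E, ∃ s : nonunits S X, r.app X s = (Sum.inr e : X ⊕ E) := by
    intro e
    obtain ⟨s, hs⟩ := hr.2 (Sum.inr e : X ⊕ E)
    refine ⟨⟨s, ?_⟩, hs⟩
    rintro ⟨x, rfl⟩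
    rw [app_pure] at hs
    cases hs
  choose f hf using hex
  refine (mk_congr (Equiv.ofBijective f ⟨?_, ?_⟩)).symm
  · intro a b h
    exact Sum.inr.inj ((hf a).symm.trans ((congrArg _ (congrArg _ h)).trans (hf b)))
  · rintro ⟨s, hs⟩
    rcases h : (r.app X s : X ⊕ E) with x | e
    · refine absurd ⟨x, hr.1 ?_⟩ hs
      rw [app_pure]
      exact h.symm
    · exact ⟨e, Subtype.ext (hr.1 ((hf e).trans h.symm))⟩

variable {P : Type u} {T : P → Monad (Type u)}

/-- A frame obtained by prescribing the sets of generators. -/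
theorem exists_frame_of_sets (hT : ∀ p, IsConsistent (T p)) {X B : Type u} (G : P → Set B)
    (hG : ∀ p, #(nonunits (T p) (G p)) = #((G p)ᶜ : Set B))
    (hd : ∀ p q, p ≠ q → ∀ b, b ∈ G p ∨ b ∈ G q) (i : X → B) (hi : Function.Injective i)
    (hmem : ∀ p x, i x ∈ G p) : Nonempty (Frame T X) := by
  classical
  -- Any bijection will do: the frame axioms only constrain where units go and which sets the
  -- nonunits fill.
  let e : ∀ p, nonunits (T p) (G p) ≃ ((G p)ᶜ : Set B) := fun p =>
    Classical.choice (Cardinal.eq.1 (hG p))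
  let φ : ∀ p, (T p).obj (G p) ≃ B := fun p =>
    (unitEquiv (hT p) (G p)).symm.trans
      ((Equiv.sumCongr (Equiv.refl _) (e p)).trans (Equiv.Set.sumCompl (G p)))
  have φ_pure : ∀ p (g : G p), φ p (pure (T p) g) = g := by
    intro p g
    simp [φ, ← unitEquiv_inl (hT p)]
  have φ_nonunit : ∀ p (s : nonunits (T p) (G p)), φ p s = e p s := by
    intro p s
    have h : (unitEquiv (hT p) (G p)).symm s = Sum.inr s := (Equiv.symm_apply_eq _).2 rfl
    simp [φ, h]
  exact ⟨{
    carrier := B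
    gen := fun p => G p
    free := φ
    incl := i
    disjoint := fun p q hpq s hs t ht h => by
      rcases hd p q hpq (φ p s) with h' | h'
      · rw [φ_nonunit p ⟨s, hs⟩] at h'
        exact (e p ⟨s, hs⟩).2 h'
      · rw [h, φ_nonunit q ⟨t, ht⟩] at h'
        exact (e q ⟨t, ht⟩).2 h'
    incl_injective := hi
    exists_gen := fun p x => ⟨⟨i x, hmem p x⟩, φ_pure p _⟩ }⟩

/-- To L is added one copy of the nonunits over L for each index, and `G p` omits only the `p`-th
copy. The total is absorbed by L, so every `G p` has the size of L and as many nonunits as its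
complement has elements. -/
theorem exists_frame_of_large_fixpoint (hT : ∀ p, IsConsistent (T p)) (X L : Type u)
    [Infinite L] (hX : #X ≤ #L) (hP : #P ≤ #L) (hL : ∀ p, #((T p).obj L) = #L) :
    Nonempty (Frame T X) := by
  obtain ⟨⟨i, hi⟩⟩ := Cardinal.le_def _ _ |>.1 hX
  have hL' : ∀ p, #(nonunits (T p) L) ≤ #L := fun p => (mk_set_le _).trans (hL p).le
  let B : Type u := L ⊕ Σ p, nonunits (T p) L
  have hB : #B ≤ #L := by
    rw [mk_sum, lift_id, lift_id, mk_sigma]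
    refine add_le_of_le (aleph0_le_mk L) le_rfl ((sum_le_sum _ _ hL').trans ?_)
    rw [sum_const, lift_id, lift_id]
    exact mul_le_of_le (aleph0_le_mk L) hP le_rfl
  let G : P → Set B := fun p => {b | ∀ s, b ≠ Sum.inr ⟨p, s⟩}
  have hGL : ∀ p, #(G p) = #L := fun p =>
    le_antisymm ((mk_set_le _).trans hB)
      (mk_le_of_injective (f := fun l => (⟨Sum.inl l, fun s => by simp⟩ : G p))
        (fun l l' h => Sum.inl.inj (congrArg Subtype.val h)))
  refine exists_frame_of_sets hT G (fun p => ?_) ?_ (fun x => Sum.inl (i x))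
    (Sum.inl_injective.comp hi) (fun p x s => by simp)
  · rw [mk_nonunits_congr (hT p) (hGL p)]
    refine mk_congr (Equiv.ofBijective
      (fun s => (⟨Sum.inr ⟨p, s⟩, fun h => h s rfl⟩ : ((G p)ᶜ : Set B))) ⟨?_, ?_⟩)
    · intro s t h
      have h' : (Sum.inr ⟨p, s⟩ : B) = Sum.inr ⟨p, t⟩ := congrArg Subtype.val h
      exact eq_of_heq (Sigma.mk.inj (Sum.inr.inj h')).2
    · rintro ⟨b, hb⟩
      simp only [G, Set.mem_compl_iff, Set.mem_ofPred_eq, not_forall, not_not] at hb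
      obtain ⟨s, rfl⟩ := hb
      exact ⟨s, rfl⟩
  · intro p q hpq b
    by_contra! h
    simp only [G, Set.mem_ofPred_eq, not_forall, not_not] at h
    obtain ⟨⟨s, rfl⟩, t, h⟩ := h
    have := (Sigma.mk.inj_iff.1 (Sum.inr.inj h)).1
    exact hpq this

/-- The carrier is a free `T o`-algebra whose generators include all the exception sets. The
complement of `G o` consists of the nonunits of `T o`, that of another `G p` of the generators from
`E p`, which has the right size whatever `G p` is, provided it is nonempty. -/
theorem exists_frame_of_unique_nonexceptional (hT : ∀ p, IsConsistent (T p)) (X : Type u) (o : P)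
    (h : ∀ p, p ≠ o → IsSubstantiallyExceptional (T p)) : Nonempty (Frame T X) := by
  choose E r hr using fun p : {p // p ≠ o} => (h p p.2).exists_hom
  -- The extra point keeps every `G p` nonempty even for empty X, as bijectivity of `r` requires.
  let L : Type u := (X ⊕ PUnit.{u + 1}) ⊕ Σ p, E p
  let B : Type u := (T o).obj L
  let G : P → Set B := fun p =>
    {b | (p = o → b ∈ Set.range (pure (T o))) ∧
      ∀ hp : p ≠ o, ∀ e, b ≠ pure (T o) (Sum.inr ⟨⟨p, hp⟩, e⟩)}
  have hGo : G o = Set.range (pure (T o)) := by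
    ext b
    exact ⟨fun hb => hb.1 rfl, fun hb => ⟨fun _ => hb, fun h => absurd rfl h⟩⟩
  have notMem : ∀ p (hp : p ≠ o) b, b ∉ G p ↔ ∃ e, pure (T o) (Sum.inr ⟨⟨p, hp⟩, e⟩) = b := by
    intro p hp b
    constructor
    · intro hb
      by_contra! hb'
      exact hb ⟨fun h => absurd h hp, fun _ e he => hb' e he.symm⟩
    · rintro ⟨e, rfl⟩ hb
      exact hb.2 hp e rfl
  have mem : ∀ p (x : X ⊕ PUnit.{u + 1}), pure (T o) (Sum.inl x) ∈ G p := by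
    intro p x
    refine ⟨fun _ => ⟨_, rfl⟩, fun hp e h => ?_⟩
    cases (hT o).pure_injective h
  refine exists_frame_of_sets hT G (fun p => ?_) ?_ (fun x => pure (T o) (Sum.inl (Sum.inl x)))
    ((hT o).pure_injective.comp (Sum.inl_injective.comp Sum.inl_injective)) (fun p x => mem p _)
  · by_cases hp : p = o
    · subst hp
      rw [hGo]
      exact mk_nonunits_congr (hT p) (mk_range_eq _ (hT p).pure_injective)
    · rw [mk_nonunits_of_exception (r ⟨p, hp⟩) (hr ⟨p, hp⟩ _ ⟨⟨_, mem p (Sum.inr ⟨⟩)⟩⟩)]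
      refine mk_congr (Equiv.ofBijective (fun e => (⟨pure (T o) (Sum.inr ⟨⟨p, hp⟩, e⟩),
        (notMem p hp _).2 ⟨e, rfl⟩⟩ : ((G p)ᶜ : Set B))) ⟨?_, ?_⟩)
      · intro e e' hee
        exact sigma_mk_injective (Sum.inr.inj ((hT o).pure_injective (congrArg Subtype.val hee)))
      · rintro ⟨b, hb⟩
        obtain ⟨e, rfl⟩ := (notMem p hp b).1 hb
        exact ⟨e, rfl⟩
  · intro p q hpq b
    by_contra! hb
    by_cases hp : p = o <;> by_cases hq : q = o
    · exact hpq (hp.trans hq.symm)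
    · obtain ⟨e, rfl⟩ := (notMem q hq b).1 hb.2
      subst hp
      exact hb.1 (hGo ▸ ⟨_, rfl⟩)
    · obtain ⟨e, rfl⟩ := (notMem p hp b).1 hb.1
      subst hq
      exact hb.2 (hGo ▸ ⟨_, rfl⟩)
    · obtain ⟨e, rfl⟩ := (notMem p hp b).1 hb.1
      obtain ⟨e', he'⟩ := (notMem q hq _).1 hb.2
      have := (Sigma.mk.inj_iff.1 (Sum.inr.inj ((hT o).pure_injective he'))).1
      exact hpq (congrArg Subtype.val this).symm

theorem exists_frame_of_jointFixpoints (hT : ∀ p, IsConsistent (T p))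
    (h : HaveArbitrarilyLargeJointFixpoints
      (fun p : {p : P // ¬ IsSubstantiallyExceptional (T p)} => (T p.1).toFunctor))
    (X : Type u) : Nonempty (Frame T X) := by
  choose E r hr using fun p : {p // IsSubstantiallyExceptional (T p)} => p.2.exists_hom
  -- Besides X and the index set, `c` must dominate all the exception sets, so that it is also a
  -- fixpoint of the substantially exceptional members.
  obtain ⟨c, hc, hfix⟩ := h (ℵ₀ + (#X + (#P + #(Σ p, E p))))
  have hL : #c.out = c := mk_out c
  have hinf : ℵ₀ ≤ c := le_self_add.trans hc
  have hrest : #X + (#P + #(Σ p, E p)) ≤ c := le_add_self.trans hc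
  have hrest' : #P + #(Σ p, E p) ≤ c := le_add_self.trans hrest
  have : Infinite c.out := infinite_iff.2 (hL.symm ▸ hinf)
  refine exists_frame_of_large_fixpoint hT X c.out (hL.symm ▸ le_self_add.trans hrest)
    (hL.symm ▸ le_self_add.trans hrest') (fun p => ?_)
  by_cases hp : IsSubstantiallyExceptional (T p)
  · rw [mk_obj (hT p), mk_nonunits_of_exception (r ⟨p, hp⟩) (hr ⟨p, hp⟩ _ inferInstance), hL]
    refine add_eq_left hinf (le_trans ?_ (le_add_self.trans hrest'))
    exact mk_le_of_injective (f := fun e => (⟨⟨p, hp⟩, e⟩ : Σ p, E p))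
      (fun e e' h => by simpa using h)
  · rw [hL]
    exact hfix ⟨p, hp⟩

theorem hasCoproduct_of_exists_frame (hT : ∀ p, IsConsistent (T p))
    (h : ∀ X : Type u, Nonempty (Frame T X)) : HasCoproduct T := by
  choose F a i hF using fun X => (Classical.choice (h X)).exists_isFreeMultialgebra hT
  exact hasCoproduct_of_isFree hF

theorem exists_frame (hT : ∀ p, IsConsistent (T p))
    (h : HaveArbitrarilyLargeJointFixpoints
        (fun p : {p : P // ¬ IsSubstantiallyExceptional (T p)} => (T p.1).toFunctor) ∨
      {p : P | ¬ IsSubstantiallyExceptional (T p)}.Subsingleton)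
    (X : Type u) : Nonempty (Frame T X) := by
  rcases h with h | h
  · exact exists_frame_of_jointFixpoints hT h X
  · by_cases ho : ∃ o, ¬ IsSubstantiallyExceptional (T o)
    · obtain ⟨o, ho⟩ := ho
      refine exists_frame_of_unique_nonexceptional hT X o (fun p hp => ?_)
      by_contra hp'
      exact hp (h hp' ho)
    · push Not at ho
      exact exists_frame_of_jointFixpoints hT
        (fun k => ⟨k, le_rfl, fun p => absurd (ho p.1) p.2⟩) X

end FrameConstructions

/-! ### From a coproduct to joint fixpoints -/

section Approximation

open Cardinal

variable {P : Type u} {T : P → Monad (Type u)}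

/-- Algebras for different monads that contain a common infinite set can be embedded in a common
carrier, so that the common set is embedded in one way. -/
theorem exists_common_extension {W : Type u} [Infinite W] {M : P → Type u}
    {m : ∀ p, (T p).obj (M p) → M p} (hm : ∀ p, IsAlgebra (T p) (m p)) (v : ∀ p, W → M p)
    (hv : ∀ p, Function.Injective (v p)) :
    ∃ (C : Type u) (c : ∀ p, (T p).obj C → C) (j : W → C) (g : ∀ p, M p → C),
      (∀ p, IsAlgebra (T p) (c p)) ∧ (∀ p, IsHom (T p) (m p) (c p) (g p)) ∧
      (∀ p, Function.Injective (g p)) ∧ ∀ p w, g p (v p w) = j w := by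
  -- This exponent exceeds W and every carrier, so all the powers `I → M p` have the same size `2 ^
  -- #I`, and the diagonal copy of W has a complement of that size in each. The powers can thus be
  -- identified along W.
  let I : Type u := W ⊕ Σ p, M p
  have hIinf : ℵ₀ ≤ #I := (aleph0_le_mk W).trans (mk_le_of_injective (Sum.inl_injective (β := _)))
  have : Nonempty I := ⟨Sum.inl (Classical.arbitrary W)⟩
  have ext : ∀ p, ∃ e : W ⊕ Set I ≃ (I → M p), ∀ w, e (Sum.inl w) = fun _ => v p w := by
    intro p
    have hMI : #(M p) ≤ #I := mk_le_of_injective (f := fun x => (Sum.inr ⟨p, x⟩ : I))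
      (fun x y h => sigma_mk_injective (Sum.inr.inj h))
    have hM : ℵ₀ ≤ #(M p) := (aleph0_le_mk W).trans (mk_le_of_injective (hv p))
    have hpow : #(I → M p) = 2 ^ #I := by
      rw [← power_def]
      exact power_eq_two_power hIinf ((natCast_lt_aleph0 (n := 2)).le.trans hM) hMI
    have hd : Function.Injective (fun w (_ : I) => v p w) :=
      fun w w' h => hv p (congrFun h (Classical.arbitrary I))
    have : Infinite (I → M p) := infinite_iff.2 (hpow ▸ hIinf.trans (cantor _).le)
    have hcompl : #(Set I) = #((Set.range (fun w (_ : I) => v p w))ᶜ : Set (I → M p)) := by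
      rw [mk_compl_of_infinite, hpow, mk_set]
      rw [mk_range_eq _ hd, hpow]
      exact (mk_le_of_injective (Sum.inl_injective (β := _))).trans_lt (cantor #I)
    obtain ⟨e⟩ := Cardinal.eq.1 hcompl
    classical
    exact ⟨(Equiv.sumCongr (Equiv.ofInjective _ hd) e).trans (Equiv.Set.sumCompl _),
      fun w => by simp⟩
  choose e he using ext
  refine ⟨W ⊕ Set I, fun p s => (e p).symm (fun i => m p (smap (T p) (fun k => k i)
    (smap (T p) (e p) s))), Sum.inl, fun p x => (e p).symm (fun _ => x),
    fun p => ((hm p).pi I).transport (e p), ?_, ?_, ?_⟩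
  · intro p s
    simp only [smap_smap, Equiv.apply_symm_apply, smap_id]
  · intro p x y h
    exact congrFun ((e p).symm.injective h) (Classical.arbitrary I)
  · intro p w
    rw [Equiv.symm_apply_eq, he]

/-! ### Labelled terms inside a weakly free multialgebra -/

variable {X F : Type u} (a : ∀ p, (T p).obj F → F) (i : X → F)

/-- Evaluation of labelled elements. -/
def eval (z : X ⊕ P × F) : F := Sum.elim i Prod.snd z

/-- The parameters together with the labelled elements of a given set. -/
def labelled (X : Type u) (A : Set (P × F)) : Set (X ⊕ P × F) :=
  {z | ∀ y, z = Sum.inr y → y ∈ A}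

/-- The parameters together with the elements of a given set with label other than `p`. -/
def labelledNe (X : Type u) (p : P) (A : Set (P × F)) : Set (X ⊕ P × F) :=
  {z | ∀ y, z = Sum.inr y → y ∈ A ∧ y.1 ≠ p}

theorem labelledNe_subset_labelled (p : P) (A : Set (P × F)) :
    labelledNe X p A ⊆ labelled X A := fun _ hz y hy => (hz y hy).1

theorem labelledNe_mono (p : P) {A B : Set (P × F)} (h : A ≤ B) :
    labelledNe X p A ⊆ labelledNe X p B := fun _ hz y hy => ⟨h (hz y hy).1, (hz y hy).2⟩

theorem inl_mem_labelledNe (p : P) (A : Set (P × F)) (x : X) :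
    Sum.inl x ∈ labelledNe X p A := fun y hy => by cases hy

theorem inr_mem_labelledNe {p : P} {A : Set (P × F)} {y : P × F} :
    Sum.inr y ∈ labelledNe X p A ↔ y ∈ A ∧ y.1 ≠ p :=
  ⟨fun h => h y rfl, fun h y' hy => by cases hy; exact h⟩

/-- Evaluation of terms in labelled elements. -/
def interpret (p : P) (A : Set (P × F)) (t : (T p).obj (labelledNe X p A)) : F :=
  a p (smap (T p) (fun z => eval i z.1) t)

/-- Enlarging the set of labelled elements. -/
def enlarge {p : P} {A B : Set (P × F)} (h : A ≤ B) :
    (T p).obj (labelledNe X p A) → (T p).obj (labelledNe X p B) :=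
  smap (T p) (Set.inclusion (labelledNe_mono p h))

theorem interpret_enlarge {p : P} {A B : Set (P × F)} (h : A ≤ B)
    (t : (T p).obj (labelledNe X p A)) :
    interpret a i p B (enlarge h t) = interpret a i p A t :=
  congrArg (a p) (smap_smap (T p) _ _ t)

theorem enlarge_enlarge {p : P} {A B D : Set (P × F)} (h : A ≤ B) (h' : B ≤ D)
    (t : (T p).obj (labelledNe X p A)) :
    enlarge h' (enlarge h t) = enlarge (h.trans h') t := smap_smap (T p) _ _ t

theorem enlarge_mem_nonunits (hT : ∀ p, IsConsistent (T p)) {p : P} {A B : Set (P × F)}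
    (h : A ≤ B) {t : (T p).obj (labelledNe X p A)}
    (ht : t ∈ nonunits (T p) (labelledNe X p A)) :
    enlarge h t ∈ nonunits (T p) (labelledNe X p B) :=
  smap_mem_nonunits (hT p) (Set.inclusion_injective _) ht

/-- The one-step operator on sets of labelled elements. -/
def labelStep (hT : ∀ p, IsConsistent (T p)) : Set (P × F) →o Set (P × F) where
  toFun A := {y | ∃ t ∈ nonunits (T y.1) (labelledNe X y.1 A), interpret a i y.1 A t = y.2}
  monotone' := by
    rintro A B h y ⟨t, ht, hy⟩
    exact ⟨enlarge h t, enlarge_mem_nonunits hT h ht, (interpret_enlarge a i h t).trans hy⟩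

/-- The approximations to the least fixed point of `labelStep`. -/
noncomputable def approx (hT : ∀ p, IsConsistent (T p)) (o : Ordinal.{u}) : Set (P × F) :=
  OrdinalApprox.lfpApprox (labelStep a i hT) ⊥ o

theorem approx_mono (hT : ∀ p, IsConsistent (T p)) : Monotone (approx a i hT) :=
  OrdinalApprox.lfpApprox_mono_right _

theorem mem_approx (hT : ∀ p, IsConsistent (T p)) {o : Ordinal.{u}} {y : P × F} :
    y ∈ approx a i hT o ↔ ∃ j < o, ∃ t ∈ nonunits (T y.1) (labelledNe X y.1 (approx a i hT j)),
      interpret a i y.1 (approx a i hT j) t = y.2 := by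
  rw [approx, OrdinalApprox.lfpApprox]
  simp only [Set.bot_eq_empty, Set.sup_eq_union, Set.empty_union, Set.iSup_eq_iUnion,
    Set.mem_iUnion, exists_prop]
  rfl

variable {a i} in
theorem interpret_pure (ha : ∀ p, IsAlgebra (T p) (a p)) {p : P} {A : Set (P × F)}
    (z : labelledNe X p A) : interpret a i p A (pure (T p) z) = eval i z.1 := by
  rw [interpret, smap_pure, (ha p).pure]

variable {a i} in
/-- Every labelled element is the value of a distinguished term. -/
theorem exists_term (hT : ∀ p, IsConsistent (T p)) (ha : ∀ p, IsAlgebra (T p) (a p))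
    (o : Ordinal.{u}) (p : P) (z : labelled X (approx a i hT o)) :
    ∃ t : (T p).obj (labelledNe X p (approx a i hT o)), interpret a i p _ t = eval i z.1 ∧
      ((∃ h : z.1 ∈ labelledNe X p (approx a i hT o), pure (T p) ⟨z.1, h⟩ = t) ∨
        ∃ y, z.1 = Sum.inr (p, y) ∧ ∃ (j : Ordinal.{u}) (hj : j < o),
          ∃ t' ∈ nonunits (T p) (labelledNe X p (approx a i hT j)),
            enlarge (approx_mono a i hT hj.le) t' = t) := by
  by_cases h : z.1 ∈ labelledNe X p (approx a i hT o)
  · exact ⟨_, interpret_pure ha _, Or.inl ⟨h, rfl⟩⟩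
  · obtain ⟨x | ⟨q, y⟩, hz⟩ := z
    · exact absurd (inl_mem_labelledNe p _ x) h
    · have hy := hz _ rfl
      obtain rfl : q = p := by
        by_contra hqp
        exact h (inr_mem_labelledNe.2 ⟨hy, hqp⟩)
      obtain ⟨j, hj, t, ht, hty⟩ := (mem_approx a i hT).1 hy
      exact ⟨enlarge (approx_mono a i hT hj.le) t, (interpret_enlarge a i _ t).trans hty,
        Or.inr ⟨y, rfl, j, hj, t, ht, rfl⟩⟩

variable {a i} in
-- Each free algebra on the labels other than `p` contains all labelled elements up to stage `o`,
-- those labelled `p` being represented by terms from earlier stages. Amalgamating these algebras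
-- along the labelled elements gives a multialgebra C; weak freeness maps F to C by some `h`. The
-- composite of `h` with interpretation is the embedding `g p`, so interpretation is injective.
theorem interpret_injective (hT : ∀ p, IsConsistent (T p)) [Infinite X]
    (ha : ∀ p, IsAlgebra (T p) (a p))
    (hF : ∀ ⦃C : Type u⦄ (c : ∀ p, (T p).obj C → C), (∀ p, IsAlgebra (T p) (c p)) →
      ∀ f : X → C, ∃ h : F → C, (∀ p, IsHom (T p) (a p) (c p) h) ∧ ∀ x, h (i x) = f x)
    (o : Ordinal.{u}) : ∀ p, Function.Injective (interpret a i p (approx a i hT o)) := by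
  induction o using WellFoundedLT.induction with
  | ind o ih =>
  choose v hv hvt using exists_term hT ha o
  have hvinj : ∀ p, Function.Injective (v p) := by
    intro p z z' h
    rcases hvt p z with ⟨hz, e⟩ | ⟨y, hy, j, hj, t, ht, e⟩ <;>
      rcases hvt p z' with ⟨hz', e'⟩ | ⟨y', hy', j', hj', t', ht', e'⟩
    · have := (hT p).pure_injective ((e.trans h).trans e'.symm)
      exact Subtype.ext (Subtype.mk.inj this)
    · exact absurd ⟨_, (e.trans h).trans e'.symm⟩ (enlarge_mem_nonunits hT _ ht')
    · exact absurd ⟨_, (e'.trans h.symm).trans e.symm⟩ (enlarge_mem_nonunits hT _ ht)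
    · have h1 := hv p z
      have h2 := hv p z'
      rw [h, h2, hy, hy'] at h1
      have h3 : y' = y := h1
      exact Subtype.ext (by rw [hy, hy', h3])
  have : Infinite (labelled X (approx a i hT o)) :=
    Infinite.of_injective (fun x : X => ⟨Sum.inl x, fun y hy => by cases hy⟩)
      (fun x x' h => Sum.inl_injective (congrArg Subtype.val h))
  obtain ⟨C, c, j, g, hc, hg, hginj, hgv⟩ :=
    exists_common_extension (T := T) (W := labelled X (approx a i hT o))
      (fun p => isAlgebra_join (S := T p)) v hvinj
  obtain ⟨h, hh, hhx⟩ := hF c hc (fun x => j ⟨Sum.inl x, fun y hy => by cases hy⟩)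
  have gen : ∀ p (z : labelledNe X p (approx a i hT o)),
      g p (pure (T p) z) = j ⟨z.1, labelledNe_subset_labelled p _ z.2⟩ := by
    intro p z
    rw [← hgv p]
    rcases hvt p ⟨z.1, labelledNe_subset_labelled p _ z.2⟩ with ⟨_, e⟩ | ⟨y, hy, _⟩
    · rw [← e]
    · exact absurd rfl (z.2 _ hy).2
  have term : ∀ p (k : Ordinal.{u}) (hk : k ≤ o) (t : (T p).obj (labelledNe X p (approx a i hT k))),
      (∀ z : labelledNe X p (approx a i hT k), h (eval i z.1) = j ⟨z.1,
        labelledNe_subset_labelled p _ (labelledNe_mono p (approx_mono a i hT hk) z.2)⟩) →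
      h (interpret a i p _ t) = g p (enlarge (approx_mono a i hT hk) t) := by
    intro p k hk t hz
    rw [interpret, hh, smap_smap, ← join_smap_pure (T p) (enlarge _ t), hg, enlarge, smap_smap,
      smap_smap]
    refine congrArg _ (smap_congr _ (fun z => ?_) t)
    rw [hz, gen]
  -- A second induction, on the stage at which a labelled element appears, shows that `h` sends it
  -- to its designated point of C.
  have key : ∀ (k : Ordinal.{u}) (hk : k ≤ o) (y : P × F) (hy : y ∈ approx a i hT k),
      h y.2 = j ⟨Sum.inr y, fun y' hy' => by
        cases hy'; exact approx_mono a i hT hk hy⟩ := by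
    intro k
    induction k using WellFoundedLT.induction with
    | ind k ihk =>
    rintro hk ⟨p, y⟩ hy
    obtain ⟨l, hl, t, -, hty⟩ := (mem_approx a i hT).1 hy
    have hlo := hl.trans_le hk
    rw [← hgv p]
    change h y = _
    refine ((congrArg h hty.symm).trans (term p l hlo.le t ?_)).trans ?_
    rotate_left
    · rcases hvt p ⟨Sum.inr (p, y), fun y' hy' => by
        cases hy'; exact approx_mono a i hT hk hy⟩ with ⟨hz, -⟩ | ⟨y', hy', l', hl', t', ht', e⟩
      · exact absurd rfl (inr_mem_labelledNe.1 hz).2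
      · have hty' := hv p ⟨Sum.inr (p, y), fun y' hy' => by
          cases hy'; exact approx_mono a i hT hk hy⟩
        rw [← e] at hty' ⊢
        rw [interpret_enlarge] at hty'
        -- The element has two terms: `t`, provided by membership at stage `k`, and `t'`, selected
        -- in the definition of `v`. Both live strictly below `o`, so injectivity at the later of
        -- their stages identifies them.
        have := ih (max l l') (max_lt hlo hl') p
          (a₁ := enlarge (approx_mono a i hT (le_max_left l l')) t)
          (a₂ := enlarge (approx_mono a i hT (le_max_right l l')) t')
          (by rw [interpret_enlarge, interpret_enlarge]; exact hty.trans hty'.symm)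
        have h2 := congrArg (enlarge (approx_mono a i hT (max_lt hlo hl').le)) this
        rw [enlarge_enlarge, enlarge_enlarge] at h2
        rw [h2]
    · rintro ⟨x | y', hz⟩
      · exact hhx x
      · exact ihk l hl hlo.le y' (inr_mem_labelledNe.1 hz).1
  intro p s t hst
  have final : ∀ t, h (interpret a i p (approx a i hT o) t) = g p t := by
    intro t
    rw [term p o le_rfl t ?_]
    · exact congrArg (g p) (smap_id (T p) t)
    · rintro ⟨x | y', hz⟩
      · exact hhx x
      · exact key o le_rfl y' (inr_mem_labelledNe.1 hz).1
  exact hginj p (by rw [← final, ← final, hst])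

/-- A weakly initial family of algebras bounds a solution of the system of equations
`A p ≃ nonunits (X + Σ q ≠ p, A q)`. -/
theorem exists_generators (hT : ∀ p, IsConsistent (T p)) [Infinite X]
    (ha : ∀ p, IsAlgebra (T p) (a p))
    (hF : ∀ ⦃C : Type u⦄ (c : ∀ p, (T p).obj C → C), (∀ p, IsAlgebra (T p) (c p)) →
      ∀ f : X → C, ∃ h : F → C, (∀ p, IsHom (T p) (a p) (c p) h) ∧ ∀ x, h (i x) = f x) :
    ∃ G : P → Type u, (∀ p, #X ≤ #(G p)) ∧
      ∀ p q, q ≠ p → #(nonunits (T q) (G q)) ≤ #(G p) := by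
  set A := (labelStep a i hT).lfp with hA
  have hinj : ∀ p, Function.Injective (interpret a i p A) := by
    rw [hA, ← OrdinalApprox.lfpApprox_ord_eq_lfp]
    exact interpret_injective hT ha hF _
  refine ⟨fun p => labelledNe X p A, fun p => ?_, fun p q hqp => ?_⟩
  · exact mk_le_of_injective (f := fun x => (⟨Sum.inl x, inl_mem_labelledNe p A x⟩ :
      labelledNe X p A)) (fun x y h => Sum.inl_injective (congrArg Subtype.val h))
  · have mem : ∀ t ∈ nonunits (T q) (labelledNe X q A), (q, interpret a i q A t) ∈ A := by
      intro t ht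
      exact (labelStep a i hT).map_lfp.subset ⟨t, ht, rfl⟩
    refine mk_le_of_injective (f := fun t : nonunits (T q) (labelledNe X q A) =>
      (⟨Sum.inr (q, interpret a i q A t), inr_mem_labelledNe.2 ⟨mem t.1 t.2, hqp⟩⟩ :
        labelledNe X p A)) ?_
    intro s t h
    exact Subtype.ext (hinj q (congrArg Prod.snd (Sum.inr_injective (congrArg Subtype.val h))))

/-- For distinct p and q that are not substantially exceptional, `G p` is bounded by its own
nonunits, these by `G q`, and symmetrically back. So all these sets share one cardinality, which
adding the nonunits does not increase. -/
theorem haveArbitrarilyLargeJointFixpoints_of_hasCoproduct (hT : ∀ p, IsConsistent (T p))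
    [HasCoproduct T] (h : ¬ {p : P | ¬ IsSubstantiallyExceptional (T p)}.Subsingleton) :
    HaveArbitrarilyLargeJointFixpoints
      (fun p : {p : P // ¬ IsSubstantiallyExceptional (T p)} => (T p.1).toFunctor) := by
  intro k
  choose b hb using fun p : {p : P // ¬ IsSubstantiallyExceptional (T p)} =>
    exists_mk_le_mk_nonunits (hT p) p.2
  -- X is infinite, above the required bound `k`, and above every threshold `b p` past which
  -- nonunits are numerous; each `G p` inherits all this.
  let X : Type u := (ℵ₀ + (k + Cardinal.sum b)).out
  have hX : #X = ℵ₀ + (k + Cardinal.sum b) := mk_out _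
  have : Infinite X := infinite_iff.2 (hX.symm ▸ le_self_add)
  obtain ⟨F, a, i, ha, hF⟩ := exists_multialgebra_of_hasCoproduct T X
  obtain ⟨G, hXG, hG⟩ := exists_generators a i hT ha hF
  have hXk : k + Cardinal.sum b ≤ #X := hX.symm ▸ le_add_self
  have hinf : ∀ p, ℵ₀ ≤ #(G p) := fun p => (aleph0_le_mk X).trans (hXG p)
  have hle : ∀ p, ¬ IsSubstantiallyExceptional (T p) → #(G p) ≤ #(nonunits (T p) (G p)) :=
    fun p hp => hb ⟨p, hp⟩ (G p) (infinite_iff.2 (hinf p))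
      (((le_sum b ⟨p, hp⟩).trans le_add_self).trans (hXk.trans (hXG p)))
  have heq : ∀ p q, ¬ IsSubstantiallyExceptional (T p) → ¬ IsSubstantiallyExceptional (T q) →
      #(G p) = #(G q) := by
    intro p q hp hq
    by_cases hpq : p = q
    · rw [hpq]
    · exact le_antisymm ((hle p hp).trans (hG q p hpq)) ((hle q hq).trans (hG p q (Ne.symm hpq)))
  obtain ⟨o, ho, o', ho', hoo⟩ := Set.not_subsingleton_iff.1 h
  refine ⟨#(G o), le_self_add.trans (hXk.trans (hXG o)), ?_⟩
  rintro ⟨p, hp⟩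
  -- The nonunits over `G p` are bounded only through a different index, so a second monad that is
  -- not substantially exceptional is needed.
  obtain ⟨q, hq, hpq⟩ : ∃ q, ¬ IsSubstantiallyExceptional (T q) ∧ p ≠ q := by
    by_cases hpo : p = o
    · exact ⟨o', ho', hpo ▸ hoo⟩
    · exact ⟨o, ho, hpo⟩
  have hN : #(nonunits (T p) (#(G o)).out) = #(nonunits (T p) (G p)) :=
    mk_nonunits_congr (hT p) ((mk_out _).trans (heq o p ho hp))
  have hN' : #(nonunits (T p) (G p)) ≤ #(G o) := (hG q p hpq).trans (heq q o hq ho).le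
  change #((T p).obj (#(G o)).out) = #(G o)
  rw [mk_obj (hT p), hN, mk_out]
  exact add_eq_left (hinf o) hN'

end Approximation

end SetMonad

/-- A family of consistent monads on `Set` has a coproduct in the category of monads iff the
members that are not substantially exceptional have arbitrarily large joint fixpoints, or at most
one member is not substantially exceptional. -/
theorem mainTheorem9 {P : Type u} (S : P → CategoryTheory.Monad (Type u))
    (hS : ∀ p, SetMonad.IsConsistent (S p)) :
    CategoryTheory.Limits.HasCoproduct S ↔
      SetMonad.HaveArbitrarilyLargeJointFixpoints
          (fun p : {p : P // ¬ SetMonad.IsSubstantiallyExceptional (S p)} => (S p.1).toFunctor) ∨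
        {p : P | ¬ SetMonad.IsSubstantiallyExceptional (S p)}.Subsingleton := by
  constructor
  · intro _
    by_cases h : {p : P | ¬ SetMonad.IsSubstantiallyExceptional (S p)}.Subsingleton
    · exact Or.inr h
    · exact Or.inl (SetMonad.haveArbitrarilyLargeJointFixpoints_of_hasCoproduct hS h)
  · exact fun h => SetMonad.hasCoproduct_of_exists_frame hS (SetMonad.exists_frame hS h)
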